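/- Let $\Sigma=\{0,1,\#\}$. An online probabilistic Turing machine (OPTM) is a probabilistic Turing machine with finitely many control states, a read-only input tape whose head never moves to the left, and one read-write work tape whose cells hold a symbol of $\Sigma$ or are blank (initially all are blank); in each step it flips a fair coin. Let $p_M(w)$ be the probability, over all coin flips, that $M$ on input $w\in\Sigma^*$ halts in an accepting state. The machine is not required to halt, and a computation that never halts counts as rejecting. The space used on $w$ is the largest number, over all outcomes of the coin flips, of work-tape cells scanned during the computation. For $s:\mathbb N\to\mathbb N$, let $OBPSPACE(s)$ be the class of languages $L\subseteq\Sigma^*$ for which there is an OPTM $M$ such that, for each $w\in\Sigma^*$: (i) if $w\in L$ then $p_M(w)\ge 2/3$; (ii) if $w\notin L$ then $p_M(w)<1/3$; (iii) $M$ uses at most $\max(1,s(|w|))$ cells of the work tape on $w$, whatever the outcomes of the coin flips. For a real constant $c>0$, $OBPSPACE(c\,n^{1/3})$ denotes $OBPSPACE(s)$ with $s(n)=\lfloor c\,n^{1/3}\rfloor$. For $x,y\in\{0,1\}^m$, let $DISJ_m(x,y)=1$ if there is no index $i$ with $x_i=y_i=1$, and $DISJ_m(x,y)=0$ otherwise.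 Let $$L_{DISJ}=\bigl\{\,1^k\#(x\#y\#x\#)^{2^k} \;:\; k\ge 1,\ x,y\in\{0,1\}^{2^{2k}},\ DISJ_{2^{2k}}(x,y)=1\,\bigr\}.$$ Theorem. There exists a constant $c_1>0$ such that $L_{DISJ}\notin OBPSPACE(c_1 n^{1/3})$. -/

import Mathlib

open MeasureTheory

noncomputable section

/-- The ternary alphabet `{0, 1, #}`. -/
inductive TapeSymbol where
  | zero
  | one
  | sep

/-- The symbol that represents a bit. -/
def TapeSymbol.ofBit : Bool → TapeSymbol
  | false => TapeSymbol.zero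
  | true => TapeSymbol.one

/-! ### Online probabilistic Turing machines -/

/-- Moves of the head of the work tape. -/
inductive WorkMove where
  | left
  | stay
  | right

/-- The displacement of the head of the work tape. -/
def WorkMove.offset : WorkMove → ℤ
  | left => -1
  | stay => 0
  | right => 1

/-- Moves of the head of the (one-way) input tape: it never moves to the left. -/
inductive InputMove where
  | stay
  | right

/-- The displacement of the head of the input tape. -/
def InputMove.offset : InputMove → ℕ
  | stay => 0
  | right => 1

/-- What a machine does in one step. A work-tape cell holds a symbol of the alphabet or is
blank (`none`). -/
structure OPTMAction (Q : Type) where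
  /-- The next control state. -/
  next : Q
  /-- The content written on the scanned work-tape cell. -/
  write : Option TapeSymbol
  /-- The move of the work-tape head, after writing. -/
  workMove : WorkMove
  /-- The move of the input-tape head. -/
  inputMove : InputMove

/-- An online (one-way) probabilistic Turing machine, with a one-way read-only input tape and one
two-way read-write work tape. In each step one fair coin is flipped, and the action depends on the
control state, on the two scanned cells and on the coin. Steps are made only from states that are
not halting. -/
structure OPTM where
  /-- The control states. -/
  Q : Type
  finite_Q : Finite Q
  /-- The initial state. -/
  start : Q
  /-- The states in which the machine stops. -/
  halting : Set Q
  /-- The states in which the machine accepts if it stops. -/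
  accepting : Set Q
  /-- State, scanned input cell, scanned work cell, coin. -/
  trans : Q → Option TapeSymbol → Option TapeSymbol → Bool → OPTMAction Q

namespace OPTM

/-- A configuration: control state, positions of both heads, content of the work tape. -/
structure Config (M : OPTM) where
  state : M.Q
  inputPos : ℕ
  workPos : ℤ
  work : ℤ → Option TapeSymbol

variable (M : OPTM)

/-- Initially the work tape is blank and the input head scans the first symbol of the input. -/
def init : M.Config where
  state := M.start
  inputPos := 0
  workPos := 0
  work := fun _ => none

open Classical in
/-- One step on the input `w` with coin `b`; a halted configuration does not change. The input
tape is blank to the right of `w`. -/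
def step (w : List TapeSymbol) (b : Bool) (C : M.Config) : M.Config :=
  if C.state ∈ M.halting then C
  else
    let a := M.trans C.state w[C.inputPos]? (C.work C.workPos) b
    { state := a.next
      inputPos := C.inputPos + a.inputMove.offset
      workPos := C.workPos + a.workMove.offset
      work := Function.update C.work C.workPos a.write }

/-- The configuration after `t` steps on the input `w`, where `ω i` is the outcome of the coin
flip of step number `i`. -/
def run (w : List TapeSymbol) (ω : ℕ → Bool) : ℕ → M.Config
  | 0 => M.init
  | t + 1 => M.step w (ω t) (run w ω t)

/-- On the input `w` and the coin flips `ω` the machine halts in an accepting state. -/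
def Accepts (w : List TapeSymbol) (ω : ℕ → Bool) : Prop :=
  ∃ t, (M.run w ω t).state ∈ M.halting ∧ (M.run w ω t).state ∈ M.accepting

/-- The law of an infinite sequence of independent fair coin flips. -/
def coinFlips : Measure (ℕ → Bool) :=
  Measure.infinitePi fun _ : ℕ => (PMF.uniformOfFintype Bool).toMeasure

/-- The probability that the machine accepts `w`. -/
def acceptProb (w : List TapeSymbol) : ℝ :=
  coinFlips.real {ω | M.Accepts w ω}

/-- The work-tape cells that the machine scans on the input `w` with coin flips `ω`. -/
def cellsUsed (w : List TapeSymbol) (ω : ℕ → Bool) : Set ℤ :=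
  Set.range fun t => (M.run w ω t).workPos

/-- On the input `w`, whatever the outcomes of the coin flips are, the machine uses at most `m`
cells of the work tape. Since the cell that is scanned at the start is always among the cells used,
a bound `m = 0` is read as `1`, as is usual for space bounds. -/
def UsesSpaceAtMost (w : List TapeSymbol) (m : ℕ) : Prop :=
  ∀ ω : ℕ → Bool, (M.cellsUsed w ω).encard ≤ ((max 1 m : ℕ) : ℕ∞)

end OPTM

/-- The languages that are recognized with bounded error by an online probabilistic Turing machine
in space `s`. The machine need not halt. -/
def OBPSPACE (s : ℕ → ℕ) : Set (Language TapeSymbol) :=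
  {L | ∃ M : OPTM, ∀ w : List TapeSymbol,
    (w ∈ L → 2 / 3 ≤ M.acceptProb w) ∧
    (w ∉ L → M.acceptProb w < 1 / 3) ∧
    M.UsesSpaceAtMost w (s w.length)}

/-! ### The disjointness language -/

/-- The disjointness function: it is true if and only if there is no `i` with `x i = y i = 1`. -/
def DISJ {n : ℕ} (x y : Fin n → Bool) : Bool :=
  decide (∀ i, (!x i || !y i) = true)

/-- A bit string as a word over the ternary alphabet. -/
def bitWord {n : ℕ} (x : Fin n → Bool) : List TapeSymbol :=
  List.ofFn fun i => TapeSymbol.ofBit (x i)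

/-- The word `x#y#x#`. -/
def disjBlock {n : ℕ} (x y : Fin n → Bool) : List TapeSymbol :=
  bitWord x ++ [TapeSymbol.sep] ++ bitWord y ++ [TapeSymbol.sep] ++ bitWord x ++ [TapeSymbol.sep]

/-- The word `1^k # (x#y#x#)^(2^k)`. -/
def disjWord (k : ℕ) (x y : Fin (2 ^ (2 * k)) → Bool) : List TapeSymbol :=
  List.replicate k TapeSymbol.one ++ [TapeSymbol.sep] ++ (List.replicate (2 ^ k) (disjBlock x y)).flatten

/-- The language of all `1^k # (x#y#x#)^(2^k)` with `k ≥ 1`, where `x` and `y` are bit strings of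
length `2^(2k)` with `DISJ x y = 1`. -/
def LDISJ : Language TapeSymbol :=
  {w | ∃ k : ℕ, 1 ≤ k ∧ ∃ x y : Fin (2 ^ (2 * k)) → Bool, DISJ x y = true ∧ w = disjWord k x y}

end

open Finset
open scoped BigOperators

/-! The word consists of `3 * 2 ^ k` blocks depending on `x` alone or on `y` alone, preceded by a
fixed prefix. Since the input head never returns, a run is a one-way protocol between two players
whose message at each block boundary is the current configuration. With at most `K` configurations
per input position, summing over the configurations at all boundaries writes the acceptance
probability, up to a small error, as a sum of at most `(K + 1) ^ (3 * 2 ^ k + 1)` products `a x * b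
y` with values in `[0, 1]` (`OPTM.exists_hasRectRank`).

A function separating disjoint from intersecting pairs in `{0,1}^n` needs exponentially many
products (`HasRectRank.exp_le_of_disjointness`). This is a corruption bound. Split the coordinates
at random into `D` and its complement, and let `x`, `y` be random subsets of the two sides: they are
disjoint. Forcing a random coordinate `i` into both sets makes them intersect. A bounded function on
the cube that is not exponentially small on average has little correlation with most coordinates
(`sum_abs_bias_le`), so forcing `i` hardly lowers the mass of a product (`rectangle_corruption`).
Hence the sum cannot be large on disjoint pairs and small on intersecting ones unless it has very
many terms.

Put `B = 2 ^ k`, so `n = B ^ 2` and the input length is of order `B ^ 3`. Space `c B` gives `log K`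
of order `c B` plus a constant, and the logarithm of the number of products is of order `c B ^ 2 +
O(B)`. The corruption bound demands order `B ^ 2`, a contradiction for small `c` and large `k`. -/

/-- The coordinatewise conjunction of two bit strings. -/
def meet {ι : Type} (D u : ι → Bool) : ι → Bool := fun i => D i && u i

/-- The coordinatewise negation of a bit string. -/
def negBits {ι : Type} (D : ι → Bool) : ι → Bool := fun i => !D i

theorem meet_update_update {ι : Type} [DecidableEq ι] (D u : ι → Bool) (i : ι) (b c : Bool) :
    meet (Function.update D i b) (Function.update u i c) =
      Function.update (meet D u) i (b && c) := by
  funext j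
  by_cases h : j = i
  · subst h; simp [meet]
  · simp [meet, h]

theorem negBits_update {ι : Type} [DecidableEq ι] (D : ι → Bool) (i : ι) (b : Bool) :
    negBits (Function.update D i b) = Function.update (negBits D) i (!b) := by
  funext j
  by_cases h : j = i
  · subst h; simp [negBits]
  · simp [negBits, h]

/-! ### Biases on the cube and corruption of rectangles -/

section Cube

variable {ι : Type} [Fintype ι] [DecidableEq ι]

/-- The value `±1` of a bit. -/
noncomputable def bitSign (b : Bool) : ℝ := if b then 1 else -1

theorem abs_bitSign (b : Bool) : |bitSign b| = 1 := by
  cases b <;> simp [bitSign]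

theorem expect_cube_eq_expect_update (i : ι) (F : (ι → Bool) → ℝ) :
    𝔼 u, F u = 𝔼 u : ι → Bool, (F (Function.update u i true) + F (Function.update u i false)) / 2 := by
  let e : (ι → Bool) ≃ (ι → Bool) :=
    Function.Involutive.toPerm (fun u => Function.update u i (!u i)) (fun u => by simp)
  have h1 : 𝔼 u, F u = 𝔼 u, F (e u) := (Fintype.expect_equiv e _ _ (fun _ => rfl)).symm
  have h2 : 𝔼 u, F u = 𝔼 u, (F u + F (e u)) / 2 := by
    rw [← Finset.expect_div, Finset.expect_add_distrib, ← h1]; ring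
  rw [h2]
  refine Finset.expect_congr rfl fun u _ => ?_
  have he : e u = Function.update u i (!u i) := rfl
  rw [he]
  cases h : u i
  · have : Function.update u i false = u := by rw [← h]; simp
    rw [this, Bool.not_false]; ring
  · have : Function.update u i true = u := by rw [← h]; simp
    rw [this, Bool.not_true]

/-- Independence factors the expectation into `n` factors `cosh ε`, whatever the signs, since `cosh`
is even; each is at most `exp (ε ^ 2 / 2)`. -/
theorem expect_exp_signs_le (ε : ℝ) (s : ι → ℝ) (hs : ∀ i, |s i| = 1) :
    𝔼 u : ι → Bool, Real.exp (ε * ∑ i, s i * bitSign (u i)) ≤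
      Real.exp (ε ^ 2 * Fintype.card ι / 2) := by
  have h1 : ∑ u : ι → Bool, Real.exp (ε * ∑ i, s i * bitSign (u i)) =
      ∏ i : ι, ∑ b : Bool, Real.exp (ε * (s i * bitSign b)) := by
    rw [Finset.prod_univ_sum, Fintype.piFinset_univ]
    refine Finset.sum_congr rfl fun u _ => ?_
    rw [← Real.exp_sum, Finset.mul_sum]
  have h2 : ∀ i, ∑ b : Bool, Real.exp (ε * (s i * bitSign b)) = 2 * Real.cosh ε := by
    intro i
    rw [Real.cosh_eq]
    rcases (abs_eq (by norm_num)).1 (hs i) with h | h <;> simp [h, bitSign] <;> ring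
  rw [Fintype.expect_eq_sum_div_card, h1, Finset.prod_congr rfl fun i _ => h2 i]
  simp only [Finset.prod_const, Finset.card_univ, Fintype.card_fun, Fintype.card_bool]
  rw [mul_pow]
  push_cast
  rw [mul_div_cancel_left₀ _ (by positivity)]
  calc Real.cosh ε ^ Fintype.card ι ≤ Real.exp (ε ^ 2 / 2) ^ Fintype.card ι :=
        pow_le_pow_left₀ (Real.cosh_pos _).le (Real.cosh_le_exp_half_sq _) _
    _ = _ := by rw [← Real.exp_nat_mul]; congr 1; ring

/-- A Chernoff-type replacement for an entropy argument: either the total bias is at most `ε n`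
times the mean of `f`, or exponential tilting shows that this mean is itself exponentially small,
and then the trivial bound `n` times the mean suffices. -/
theorem sum_abs_bias_le (ε : ℝ) (hε : 0 ≤ ε) (f : (ι → Bool) → ℝ) (h0 : ∀ u, 0 ≤ f u)
    (h1 : ∀ u, f u ≤ 1) :
    ∑ i, |𝔼 u, f u * bitSign (u i)| ≤
      Fintype.card ι * (ε * (𝔼 u, f u) + Real.exp (-(ε ^ 2 * Fintype.card ι / 2))) := by
  set n : ℝ := ((Fintype.card ι : ℕ) : ℝ) with hn
  have hn0 : 0 ≤ n := by positivity
  set p := 𝔼 u, f u with hp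
  have hp0 : 0 ≤ p := Finset.expect_nonneg fun u _ => h0 u
  -- These signs turn the sum of absolute values into the single correlation of `f` with `X`.
  set s : ι → ℝ := fun i => if 0 ≤ 𝔼 u, f u * bitSign (u i) then 1 else -1 with hsdef
  have hs : ∀ i, |s i| = 1 := fun i => by simp only [hsdef]; split_ifs <;> simp
  set X : (ι → Bool) → ℝ := fun u => ∑ i, s i * bitSign (u i) with hX
  have hm : ∑ i, |𝔼 u, f u * bitSign (u i)| = 𝔼 u, f u * X u := by
    simp only [hX, Finset.mul_sum]
    rw [Finset.expect_sum_comm]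
    refine Finset.sum_congr rfl fun i _ => ?_
    have : ∀ u : ι → Bool, f u * (s i * bitSign (u i)) = s i * (f u * bitSign (u i)) :=
      fun u => by ring
    simp only [this, ← Finset.mul_expect]
    simp only [hsdef]
    split_ifs with h
    · rw [abs_of_nonneg h, one_mul]
    · rw [abs_of_neg (not_le.1 h)]; ring
  rw [hm]
  set m := 𝔼 u, f u * X u with hmdef
  by_cases hc : m ≤ ε * n * p
  · have : 0 ≤ n * Real.exp (-(ε ^ 2 * n / 2)) := by positivity
    nlinarith
  have hmn : m ≤ n * p := by
    rw [hmdef, hp, Finset.mul_expect]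
    refine Finset.expect_le_expect fun u _ => ?_
    rw [mul_comm]
    refine mul_le_mul_of_nonneg_right ?_ (h0 u)
    calc X u ≤ ∑ i : ι, (1 : ℝ) := Finset.sum_le_sum fun i _ => by
            refine (le_abs_self _).trans ?_
            rw [abs_mul, hs, abs_bitSign, one_mul]
      _ = n := by simp [hn]
  -- As `m > ε n p`, the factor `1 + ε (X - ε n)` only raises the mean of `f`; then `1 + z ≤ exp z`.
  have hlow : p ≤ 𝔼 u, f u * Real.exp (ε * (X u - ε * n)) := by
    have : p ≤ 𝔼 u, f u * (1 + ε * (X u - ε * n)) := by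
      have e : ∀ u, f u * (1 + ε * (X u - ε * n)) =
          f u + ε * (f u * X u) - ε * (ε * n) * f u := fun u => by ring
      simp only [e, Finset.expect_sub_distrib, Finset.expect_add_distrib, ← Finset.mul_expect]
      rw [← hp, ← hmdef]
      nlinarith [not_le.1 hc]
    refine this.trans (Finset.expect_le_expect fun u _ => mul_le_mul_of_nonneg_left ?_ (h0 u))
    linarith [Real.add_one_le_exp (ε * (X u - ε * n))]
  have hup : 𝔼 u, f u * Real.exp (ε * (X u - ε * n)) ≤ Real.exp (-(ε ^ 2 * n / 2)) := by
    calc 𝔼 u, f u * Real.exp (ε * (X u - ε * n))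
        ≤ 𝔼 u, Real.exp (-(ε ^ 2 * n)) * Real.exp (ε * X u) := by
          refine Finset.expect_le_expect fun u _ => ?_
          rw [← Real.exp_add]
          have : ε * (X u - ε * n) = -(ε ^ 2 * n) + ε * X u := by ring
          rw [this]
          exact mul_le_of_le_one_left (Real.exp_pos _).le (h1 u)
      _ ≤ Real.exp (-(ε ^ 2 * n)) * Real.exp (ε ^ 2 * n / 2) := by
          rw [← Finset.mul_expect]
          exact mul_le_mul_of_nonneg_left (expect_exp_signs_le ε s hs) (Real.exp_pos _).le
      _ = _ := by rw [← Real.exp_add]; congr 1; ring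
  have : n * p ≤ n * Real.exp (-(ε ^ 2 * n / 2)) :=
    mul_le_mul_of_nonneg_left (hlow.trans hup) hn0
  have h3 : 0 ≤ n * (ε * p) := by positivity
  linarith

/-- The average of `a` over the uniformly random subset of the set `D`. -/
noncomputable def subsetAvg (a : (ι → Bool) → ℝ) (D : ι → Bool) : ℝ := 𝔼 u, a (meet D u)

/-- The average of `a` over the uniformly random subset of `D`, with the bit `i` replaced by `b`. -/
noncomputable def subsetAvgUpdate (a : (ι → Bool) → ℝ) (i : ι) (b : Bool) (D : ι → Bool) : ℝ :=
  𝔼 u, a (Function.update (meet D u) i b)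

/-- The correlation of `a` with the bit `i` on the random subset of `D`. -/
noncomputable def subsetBias (a : (ι → Bool) → ℝ) (i : ι) (D : ι → Bool) : ℝ :=
  𝔼 u, a (meet D u) * bitSign (u i)

theorem subsetAvg_update_true (a : (ι → Bool) → ℝ) (i : ι) (D : ι → Bool) :
    subsetAvg a (Function.update D i true) =
      (subsetAvgUpdate a i true D + subsetAvgUpdate a i false D) / 2 := by
  rw [subsetAvg, expect_cube_eq_expect_update i]
  simp only [meet_update_update, ← Finset.expect_div, Finset.expect_add_distrib]
  rfl

theorem subsetAvg_update_false (a : (ι → Bool) → ℝ) (i : ι) (D : ι → Bool) :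
    subsetAvg a (Function.update D i false) = subsetAvgUpdate a i false D := by
  rw [subsetAvg, expect_cube_eq_expect_update i]
  simp only [meet_update_update, Bool.false_and, add_self_div_two]
  rfl

theorem subsetBias_update_true (a : (ι → Bool) → ℝ) (i : ι) (D : ι → Bool) :
    subsetBias a i (Function.update D i true) =
      (subsetAvgUpdate a i true D - subsetAvgUpdate a i false D) / 2 := by
  rw [subsetBias, expect_cube_eq_expect_update i]
  simp only [meet_update_update, Function.update_self, bitSign, if_true, Bool.true_and, mul_one,
    Bool.false_eq_true, if_false, mul_neg, ← sub_eq_add_neg, ← Finset.expect_div,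
    Finset.expect_sub_distrib]
  rfl

theorem subsetAvg_nonneg {a : (ι → Bool) → ℝ} (h : ∀ x, 0 ≤ a x) (D : ι → Bool) :
    0 ≤ subsetAvg a D := Finset.expect_nonneg fun _ _ => h _

theorem subsetAvg_le_one {a : (ι → Bool) → ℝ} (h : ∀ x, a x ≤ 1) (D : ι → Bool) :
    subsetAvg a D ≤ 1 := Finset.expect_le Finset.univ_nonempty fun _ _ => h _

theorem subsetAvgUpdate_nonneg {a : (ι → Bool) → ℝ} (h : ∀ x, 0 ≤ a x) (i : ι) (b : Bool)
    (D : ι → Bool) : 0 ≤ subsetAvgUpdate a i b D := Finset.expect_nonneg fun _ _ => h _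

/-- With `d = a₁ - a₀` and `e = b₁ - b₀`, the left side is `a₀ b₀ + (d b₀ + a₀ e) / 4` and the
product is `a₀ b₀ + d b₀ + a₀ e + d e`, so they differ only by terms that the absolute differences
control. The constant `9 / 4` is not optimal. -/
theorem half_sum_le_of_nonneg {a₀ a₁ b₀ b₁ : ℝ} (ha₀ : 0 ≤ a₀) (ha₁ : 0 ≤ a₁) (hb₀ : 0 ≤ b₀)
    (hb₁ : 0 ≤ b₁) :
    ((a₁ + a₀) / 2 * b₀ + a₀ * ((b₁ + b₀) / 2)) / 2 ≤
      a₁ * b₁ + 9 / 4 * (|a₁ - a₀| * b₀ + a₀ * |b₁ - b₀|) := by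
  rcases abs_cases (a₁ - a₀) with ⟨h1, h1'⟩ | ⟨h1, h1'⟩ <;>
  rcases abs_cases (b₁ - b₀) with ⟨h2, h2'⟩ | ⟨h2, h2'⟩ <;> rw [h1, h2]
  · nlinarith [mul_nonneg h1' h2', mul_nonneg h1' hb₀, mul_nonneg ha₀ h2']
  · nlinarith [mul_nonneg h1' hb₀, mul_nonneg h1' hb₁, mul_nonneg ha₀ (neg_nonneg.2 h2'.le)]
  · nlinarith [mul_nonneg (neg_nonneg.2 h1'.le) hb₀, mul_nonneg ha₁ h2', mul_nonneg ha₀ h2']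
  · nlinarith [mul_nonneg (neg_nonneg.2 h1'.le) (neg_nonneg.2 h2'.le),
      mul_nonneg (neg_nonneg.2 h1'.le) hb₀, mul_nonneg ha₀ (neg_nonneg.2 h2'.le)]

/-- Condition on the side of the partition that contains `i`, and apply `half_sum_le_of_nonneg` for
each choice of the rest. The factor `9 = 4 * (9 / 4)` arises because the bias is half of the
difference and occurs with probability one half. -/
theorem expect_mul_subsetAvg_le {a b : (ι → Bool) → ℝ} (ha : ∀ x, 0 ≤ a x) (hb : ∀ x, 0 ≤ b x)
    (i : ι) :
    𝔼 D, subsetAvg a D * subsetAvg b (negBits D) ≤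
      (𝔼 D, subsetAvgUpdate a i true D * subsetAvgUpdate b i true (negBits D)) +
      9 * (𝔼 D, |subsetBias a i D| * subsetAvg b (negBits D)) +
      9 * (𝔼 D, subsetAvg a D * |subsetBias b i (negBits D)|) := by
  rw [expect_cube_eq_expect_update i (fun D => subsetAvg a D * subsetAvg b (negBits D)),
    expect_cube_eq_expect_update i (fun D => |subsetBias a i D| * subsetAvg b (negBits D)),
    expect_cube_eq_expect_update i (fun D => subsetAvg a D * |subsetBias b i (negBits D)|),
    Finset.mul_expect, Finset.mul_expect, ← Finset.expect_add_distrib, ← Finset.expect_add_distrib]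
  refine Finset.expect_le_expect fun D _ => ?_
  simp only [negBits_update, Bool.not_true, Bool.not_false, subsetAvg_update_true,
    subsetAvg_update_false, subsetBias_update_true]
  have hA := subsetAvgUpdate_nonneg ha i
  have hB := subsetAvgUpdate_nonneg hb i
  have key := half_sum_le_of_nonneg (hA false D) (hA true D) (hB false (negBits D))
    (hB true (negBits D))
  -- The biases on the side that lacks `i` are discarded; only their nonnegativity is needed.
  have e1 : 0 ≤ |subsetBias a i (Function.update D i false)| *
      ((subsetAvgUpdate b i true (negBits D) + subsetAvgUpdate b i false (negBits D)) / 2) :=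
    mul_nonneg (abs_nonneg _) (by linarith [hB true (negBits D), hB false (negBits D)])
  have e2 : 0 ≤ (subsetAvgUpdate a i true D + subsetAvgUpdate a i false D) / 2 *
      |subsetBias b i (Function.update (negBits D) i false)| :=
    mul_nonneg (by linarith [hA true D, hA false D]) (abs_nonneg _)
  simp only [abs_div, abs_two]
  linarith

/-- A rectangle that is large under the disjoint pairs is large under the pairs that intersect in
one point. -/
theorem rectangle_corruption {a b : (ι → Bool) → ℝ} (ha : ∀ x, 0 ≤ a x) (ha' : ∀ x, a x ≤ 1)
    (hb : ∀ x, 0 ≤ b x) (hb' : ∀ x, b x ≤ 1) {ε : ℝ} (hε : 0 ≤ ε) :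
    Fintype.card ι * ((1 - 18 * ε) * 𝔼 D, subsetAvg a D * subsetAvg b (negBits D)) ≤
      (∑ i, 𝔼 D, subsetAvgUpdate a i true D * subsetAvgUpdate b i true (negBits D)) +
      Fintype.card ι * (18 * Real.exp (-(ε ^ 2 * Fintype.card ι / 2))) := by
  set n : ℝ := ((Fintype.card ι : ℕ) : ℝ) with hn
  set δ := Real.exp (-(ε ^ 2 * n / 2)) with hδ
  set T := 𝔼 D, subsetAvg a D * subsetAvg b (negBits D) with hT
  have hn0 : 0 ≤ n := by positivity
  have hsum := Finset.sum_le_sum fun i (_ : i ∈ Finset.univ) => expect_mul_subsetAvg_le ha hb i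
  simp only [Finset.sum_add_distrib, ← Finset.mul_sum, ← hT, Finset.sum_const, Finset.card_univ,
    nsmul_eq_mul, ← hn] at hsum
  -- For fixed `D`, the bias bound applies to `u ↦ c (meet D u)`, whose mean is `subsetAvg c D`.
  have bias : ∀ {c : (ι → Bool) → ℝ}, (∀ x, 0 ≤ c x) → (∀ x, c x ≤ 1) → ∀ D,
      ∑ i, |subsetBias c i D| ≤ n * (ε * subsetAvg c D + δ) := fun h h' D =>
    sum_abs_bias_le ε hε (fun u => _) (fun u => h _) (fun u => h' _)
  have h1 : ∑ i, 𝔼 D, |subsetBias a i D| * subsetAvg b (negBits D) ≤ n * (ε * T + δ) := by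
    rw [← Finset.expect_sum_comm]
    calc _ ≤ 𝔼 D : ι → Bool, (n * ε * (subsetAvg a D * subsetAvg b (negBits D)) + n * δ) := by
          refine Finset.expect_le_expect fun D _ => ?_
          rw [← Finset.sum_mul]
          have h2 := mul_le_mul_of_nonneg_right (bias ha ha' D) (subsetAvg_nonneg hb (negBits D))
          have h3 := mul_le_mul_of_nonneg_left (subsetAvg_le_one hb' (negBits D))
            (by positivity : 0 ≤ n * δ)
          linarith
      _ = _ := by
          rw [Finset.expect_add_distrib, ← Finset.mul_expect, ← hT,
            Finset.expect_const Finset.univ_nonempty]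
          ring
  have h2 : ∑ i, 𝔼 D, subsetAvg a D * |subsetBias b i (negBits D)| ≤ n * (ε * T + δ) := by
    rw [← Finset.expect_sum_comm]
    calc _ ≤ 𝔼 D : ι → Bool, (n * ε * (subsetAvg a D * subsetAvg b (negBits D)) + n * δ) := by
          refine Finset.expect_le_expect fun D _ => ?_
          rw [← Finset.mul_sum]
          have h2 := mul_le_mul_of_nonneg_left (bias hb hb' (negBits D)) (subsetAvg_nonneg ha D)
          have h3 := mul_le_mul_of_nonneg_left (subsetAvg_le_one ha' D)
            (by positivity : 0 ≤ n * δ)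
          linarith
      _ = _ := by
          rw [Finset.expect_add_distrib, ← Finset.mul_expect, ← hT,
            Finset.expect_const Finset.univ_nonempty]
          ring
  linarith

end Cube

/-! ### Rectangle rank of disjointness -/

/-- `P` is a sum of at most `R` products of a function of `x` and a function of `y`, all with values
in `[0, 1]`. -/
noncomputable def HasRectRank {X Y : Type} (R : ℕ) (P : X → Y → ℝ) : Prop :=
  ∃ (κ : Type) (_ : Fintype κ) (a : κ → X → ℝ) (b : κ → Y → ℝ), Fintype.card κ ≤ R ∧
    (∀ τ x, 0 ≤ a τ x ∧ a τ x ≤ 1) ∧ (∀ τ y, 0 ≤ b τ y ∧ b τ y ≤ 1) ∧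
    ∀ x y, P x y = ∑ τ, a τ x * b τ y

namespace HasRectRank

variable {X Y : Type}

theorem of_left {f : X → ℝ} (h0 : ∀ x, 0 ≤ f x) (h1 : ∀ x, f x ≤ 1) :
    HasRectRank 1 (fun x (_ : Y) => f x) :=
  ⟨Unit, inferInstance, fun _ => f, fun _ _ => 1, by simp, fun _ x => ⟨h0 x, h1 x⟩, by simp,
    by simp⟩

theorem of_right {f : Y → ℝ} (h0 : ∀ y, 0 ≤ f y) (h1 : ∀ y, f y ≤ 1) :
    HasRectRank 1 (fun (_ : X) y => f y) :=
  ⟨Unit, inferInstance, fun _ _ => 1, fun _ => f, by simp, by simp, fun _ x => ⟨h0 x, h1 x⟩,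
    by simp⟩

theorem add {R S : ℕ} {P Q : X → Y → ℝ} (hP : HasRectRank R P) (hQ : HasRectRank S Q) :
    HasRectRank (R + S) (fun x y => P x y + Q x y) := by
  obtain ⟨κ, _, a, b, hc, ha, hb, h⟩ := hP
  obtain ⟨κ', _, a', b', hc', ha', hb', h'⟩ := hQ
  refine ⟨κ ⊕ κ', inferInstance, Sum.elim a a', Sum.elim b b', ?_, ?_, ?_, ?_⟩
  · rw [Fintype.card_sum]; omega
  · rintro (τ | τ) x; exacts [ha τ x, ha' τ x]
  · rintro (τ | τ) x; exacts [hb τ x, hb' τ x]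
  · intro x y; simp [h, h']

theorem mono {R S : ℕ} {P : X → Y → ℝ} (hP : HasRectRank R P) (h : R ≤ S) : HasRectRank S P := by
  obtain ⟨κ, i, a, b, hc, h'⟩ := hP
  exact ⟨κ, i, a, b, hc.trans h, h'⟩

theorem left_mul {R : ℕ} {P : X → Y → ℝ} (hP : HasRectRank R P) {f : X → ℝ} (h0 : ∀ x, 0 ≤ f x)
    (h1 : ∀ x, f x ≤ 1) : HasRectRank R (fun x y => f x * P x y) := by
  obtain ⟨κ, i, a, b, hc, ha, hb, h⟩ := hP
  exact ⟨κ, i, fun τ x => f x * a τ x, b, hc, fun τ x => ⟨mul_nonneg (h0 x) (ha τ x).1,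
    mul_le_one₀ (h1 x) (ha τ x).1 (ha τ x).2⟩, hb,
    fun x y => by simp only [h, Finset.mul_sum, mul_assoc]⟩

theorem right_mul {R : ℕ} {P : X → Y → ℝ} (hP : HasRectRank R P) {f : Y → ℝ} (h0 : ∀ x, 0 ≤ f x)
    (h1 : ∀ x, f x ≤ 1) : HasRectRank R (fun x y => f y * P x y) := by
  obtain ⟨κ, i, a, b, hc, ha, hb, h⟩ := hP
  exact ⟨κ, i, a, fun τ x => f x * b τ x, hc, ha, fun τ x => ⟨mul_nonneg (h0 x) (hb τ x).1,
    mul_le_one₀ (h1 x) (hb τ x).1 (hb τ x).2⟩,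
    fun x y => by
      simp only [h, Finset.mul_sum]
      exact Finset.sum_congr rfl fun τ _ => by ring⟩

theorem sum {σ : Type} {R : ℕ} (s : Finset σ) {P : σ → X → Y → ℝ}
    (hP : ∀ c ∈ s, HasRectRank R (P c)) :
    HasRectRank (s.card * R) (fun x y => ∑ c ∈ s, P c x y) := by
  classical
  induction s using Finset.induction_on with
  | empty =>
    exact ⟨Empty, inferInstance, fun _ _ => 0, fun _ _ => 0, by simp, by simp, by simp, by simp⟩
  | insert c s hc ih =>
    have h := (hP c (by simp)).add (ih fun d hd => hP d (by simp [hd]))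
    simp only [Finset.sum_insert hc, Finset.card_insert_of_notMem hc]
    exact h.mono (by linarith)

/-- A function that separates disjoint from intersecting pairs of sets has large rectangle rank. -/
theorem exp_le_of_disjointness {ι : Type} [Fintype ι] [DecidableEq ι] [Nonempty ι] {R : ℕ}
    {P : (ι → Bool) → (ι → Bool) → ℝ} (hP : HasRectRank R P)
    (hdisj : ∀ x y, (∀ i, (!x i || !y i) = true) → 3 / 5 ≤ P x y)
    (hint : ∀ x y, (¬ ∀ i, (!x i || !y i) = true) → P x y ≤ 1 / 3) :
    Real.exp (Fintype.card ι / 10368) ≤ 180 * R := by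
  obtain ⟨κ, _, a, b, hc, ha, hb, h⟩ := hP
  set n : ℝ := ((Fintype.card ι : ℕ) : ℝ) with hn
  have hn0 : 0 < n := by rw [hn]; exact_mod_cast Fintype.card_pos
  -- With `ε = 1 / 72` the factor `1 - 18 ε` is `3 / 4`, and the error exponent is `n / (2 * 72 ^ 2)
  -- = n / 10368`.
  have key := Finset.sum_le_sum fun τ (_ : τ ∈ Finset.univ) =>
    rectangle_corruption (fun x => (ha τ x).1) (fun x => (ha τ x).2) (fun x => (hb τ x).1)
      (fun x => (hb τ x).2) (ε := 1 / 72) (by norm_num)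
  rw [Finset.sum_add_distrib, ← Finset.mul_sum, ← Finset.mul_sum, ← Finset.expect_sum_comm,
    Finset.sum_comm] at key
  simp only [← Finset.expect_sum_comm, Finset.sum_const, Finset.card_univ, nsmul_eq_mul,
    ← hn] at key
  have e1 : ∀ D, ∑ τ, subsetAvg (a τ) D * subsetAvg (b τ) (negBits D) =
      𝔼 u, 𝔼 v, P (meet D u) (meet (negBits D) v) := by
    intro D
    simp only [subsetAvg, Finset.expect_mul_expect, h, Finset.expect_sum_comm]
  have e2 : ∀ i D, ∑ τ, subsetAvgUpdate (a τ) i true D * subsetAvgUpdate (b τ) i true (negBits D) =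
      𝔼 u, 𝔼 v, P (Function.update (meet D u) i true)
        (Function.update (meet (negBits D) v) i true) := by
    intro i D
    simp only [subsetAvgUpdate, Finset.expect_mul_expect, h, Finset.expect_sum_comm]
  simp only [e1, e2] at key
  rw [Finset.expect_sum_comm] at key
  have l1 : 3 / 5 ≤ 𝔼 D, 𝔼 u, 𝔼 v, P (meet D u) (meet (negBits D) v) := by
    refine Finset.le_expect Finset.univ_nonempty fun D _ => ?_
    refine Finset.le_expect Finset.univ_nonempty fun u _ => ?_
    refine Finset.le_expect Finset.univ_nonempty fun v _ => ?_
    refine hdisj _ _ fun i => ?_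
    simp only [meet, negBits]
    cases D i <;> simp
  have l2 : ∑ i, 𝔼 D, 𝔼 u, 𝔼 v, P (Function.update (meet D u) i true)
        (Function.update (meet (negBits D) v) i true) ≤ n * (1 / 3) := by
    calc _ ≤ ∑ i : ι, (1 / 3 : ℝ) := ?_
      _ = _ := by simp [hn]
    refine Finset.sum_le_sum fun i _ => ?_
    refine Finset.expect_le Finset.univ_nonempty fun D _ => ?_
    refine Finset.expect_le Finset.univ_nonempty fun u _ => ?_
    refine Finset.expect_le Finset.univ_nonempty fun v _ => ?_
    refine hint _ _ fun hh => ?_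
    have := hh i
    simp at this
  have hδ : Real.exp (-((1 / 72 : ℝ) ^ 2 * n / 2)) = (Real.exp (n / 10368))⁻¹ := by
    rw [← Real.exp_neg]; congr 1; ring
  rw [hδ] at key
  set E := Real.exp (n / 10368) with hE
  have hE0 : 0 < E := Real.exp_pos _
  have hcR : (Fintype.card κ : ℝ) ≤ R := by exact_mod_cast hc
  -- The gap is `(3 / 4) * (3 / 5) - 1 / 3 = 7 / 60`, which exceeds `1 / 10`.
  have h3 : n * (1 / 10) ≤ n * (18 * (R * E⁻¹)) := by
    have : (Fintype.card κ : ℝ) * (n * (18 * E⁻¹)) ≤ R * (n * (18 * E⁻¹)) :=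
      mul_le_mul_of_nonneg_right hcR (by positivity)
    have h4 := mul_le_mul_of_nonneg_left l1 hn0.le
    linarith
  have h5 := le_of_mul_le_mul_left h3 hn0
  have h6 := mul_le_mul_of_nonneg_right h5 hE0.le
  have h7 : 18 * (R * E⁻¹) * E = 18 * R := by field_simp
  linarith

end HasRectRank

/-! ### Cutting a run at the segment boundaries of the input -/

namespace OPTM

variable (M : OPTM)

open Classical in
/-- The indicator of the halted accepting configurations. -/
noncomputable def acceptIndicator (C : M.Config) : ℝ :=
  if C.state ∈ M.halting ∧ C.state ∈ M.accepting then 1 else 0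

/-- The expectation of `h` after `t` steps from a configuration. -/
noncomputable def expectedAfter (w : List TapeSymbol) (h : M.Config → ℝ) : ℕ → M.Config → ℝ
  | 0, C => h C
  | t + 1, C =>
    (expectedAfter w h t (M.step w true C) + expectedAfter w h t (M.step w false C)) / 2

/-- The probability that the machine accepts within `t` steps from a configuration. -/
noncomputable def valueWithin (w : List TapeSymbol) : ℕ → M.Config → ℝ :=
  M.expectedAfter w M.acceptIndicator

/-- The expected reward if the machine runs for `t` steps, but stops as soon as the input head has
reached the position `q`. The reward is `g` if the head has reached `q`, and `h` otherwise. -/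
noncomputable def rewardUntil (w : List TapeSymbol) (q : ℕ) (h g : M.Config → ℝ) :
    ℕ → M.Config → ℝ
  | 0, C => if q ≤ C.inputPos then g C else h C
  | t + 1, C => if q ≤ C.inputPos then g C else
    (rewardUntil w q h g t (M.step w true C) + rewardUntil w q h g t (M.step w false C)) / 2

open Classical in
/-- The probability that the configuration `C'` is the one in which the input head reaches `q`,
within `t` steps. -/
noncomputable def hitProb (w : List TapeSymbol) (q : ℕ) (C' : M.Config) : ℕ → M.Config → ℝ :=
  M.rewardUntil w q (fun _ => 0) (fun C => if C = C' then 1 else 0)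

/-- The probability of acceptance within `t` steps and before the input head reaches `q`. -/
noncomputable def acceptBefore (w : List TapeSymbol) (q : ℕ) : ℕ → M.Config → ℝ :=
  M.rewardUntil w q M.acceptIndicator (fun _ => 0)

variable {M}

theorem step_congr {w w' : List TapeSymbol} {C : M.Config} (h : w[C.inputPos]? = w'[C.inputPos]?)
    (b : Bool) : M.step w b C = M.step w' b C := by
  simp only [step, h]

theorem inputPos_le_step (w : List TapeSymbol) (b : Bool) (C : M.Config) :
    C.inputPos ≤ (M.step w b C).inputPos := by
  unfold step; split_ifs <;> simp

theorem step_inputPos_le (w : List TapeSymbol) (b : Bool) (C : M.Config) :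
    (M.step w b C).inputPos ≤ C.inputPos + 1 := by
  unfold step
  split_ifs
  · simp
  · simp only [add_le_add_iff_left]
    generalize (M.trans C.state w[C.inputPos]? (C.work C.workPos) b).inputMove = m
    cases m <;> simp [InputMove.offset]

theorem acceptIndicator_nonneg (C : M.Config) : 0 ≤ M.acceptIndicator C := by
  unfold acceptIndicator; split_ifs <;> norm_num

theorem acceptIndicator_le_one (C : M.Config) : M.acceptIndicator C ≤ 1 := by
  unfold acceptIndicator; split_ifs <;> norm_num

theorem acceptIndicator_le_step (w : List TapeSymbol) (b : Bool) (C : M.Config) :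
    M.acceptIndicator C ≤ M.acceptIndicator (M.step w b C) := by
  by_cases h : C.state ∈ M.halting
  · simp [step, h]
  · simp only [acceptIndicator, h, false_and, if_false]
    split_ifs <;> norm_num

theorem valueWithin_nonneg (w : List TapeSymbol) (t : ℕ) (C : M.Config) :
    0 ≤ M.valueWithin w t C := by
  induction t generalizing C with
  | zero => exact acceptIndicator_nonneg C
  | succ t ih =>
    have h1 := ih (M.step w true C)
    have h2 := ih (M.step w false C)
    simp only [valueWithin, expectedAfter] at *
    linarith

theorem valueWithin_le_one (w : List TapeSymbol) (t : ℕ) (C : M.Config) :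
    M.valueWithin w t C ≤ 1 := by
  induction t generalizing C with
  | zero => exact acceptIndicator_le_one C
  | succ t ih =>
    have h1 := ih (M.step w true C)
    have h2 := ih (M.step w false C)
    simp only [valueWithin, expectedAfter] at *
    linarith

theorem valueWithin_le_succ (w : List TapeSymbol) (t : ℕ) (C : M.Config) :
    M.valueWithin w t C ≤ M.valueWithin w (t + 1) C := by
  induction t generalizing C with
  | zero =>
    have h1 := acceptIndicator_le_step w true C
    have h2 := acceptIndicator_le_step w false C
    simp only [valueWithin, expectedAfter] at *
    linarith
  | succ t ih =>
    have h1 := ih (M.step w true C)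
    have h2 := ih (M.step w false C)
    simp only [valueWithin] at *
    rw [expectedAfter, expectedAfter]
    linarith

theorem valueWithin_mono (w : List TapeSymbol) (C : M.Config) :
    Monotone fun t => M.valueWithin w t C :=
  monotone_nat_of_le_succ fun t => valueWithin_le_succ w t C

theorem valueWithin_congr {w w' : List TapeSymbol} (t : ℕ) (C : M.Config)
    (h : ∀ i, C.inputPos ≤ i → w[i]? = w'[i]?) : M.valueWithin w t C = M.valueWithin w' t C := by
  induction t generalizing C with
  | zero => rfl
  | succ t ih =>
    have hs := step_congr (h _ le_rfl)
    have h1 := ih (M.step w true C) fun i hi => h i ((inputPos_le_step w true C).trans hi)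
    have h2 := ih (M.step w false C) fun i hi => h i ((inputPos_le_step w false C).trans hi)
    simp only [valueWithin] at *
    rw [expectedAfter, expectedAfter, h1, h2, hs, hs]

theorem rewardUntil_congr {w w' : List TapeSymbol} (q : ℕ) (h g : M.Config → ℝ) (t : ℕ)
    (C : M.Config) (hw : ∀ i, C.inputPos ≤ i → i < q → w[i]? = w'[i]?) :
    M.rewardUntil w q h g t C = M.rewardUntil w' q h g t C := by
  induction t generalizing C with
  | zero => rfl
  | succ t ih =>
    unfold rewardUntil
    split_ifs with hq
    · rfl
    have hs := step_congr (hw _ le_rfl (not_le.1 hq))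
    rw [ih (M.step w true C) fun i hi => hw i ((inputPos_le_step w true C).trans hi),
      ih (M.step w false C) fun i hi => hw i ((inputPos_le_step w false C).trans hi), hs, hs]

theorem rewardUntil_nonneg (w : List TapeSymbol) (q : ℕ) {h g : M.Config → ℝ} (hh : ∀ C, 0 ≤ h C)
    (hg : ∀ C, 0 ≤ g C) (t : ℕ) (C : M.Config) : 0 ≤ M.rewardUntil w q h g t C := by
  induction t generalizing C with
  | zero => unfold rewardUntil; split_ifs; exacts [hg C, hh C]
  | succ t ih =>
    unfold rewardUntil
    split_ifs
    · exact hg C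
    · linarith [ih (M.step w true C), ih (M.step w false C)]

theorem rewardUntil_le_one (w : List TapeSymbol) (q : ℕ) {h g : M.Config → ℝ} (hh : ∀ C, h C ≤ 1)
    (hg : ∀ C, g C ≤ 1) (t : ℕ) (C : M.Config) : M.rewardUntil w q h g t C ≤ 1 := by
  induction t generalizing C with
  | zero => unfold rewardUntil; split_ifs; exacts [hg C, hh C]
  | succ t ih =>
    unfold rewardUntil
    split_ifs
    · exact hg C
    · linarith [ih (M.step w true C), ih (M.step w false C)]

variable (M) in
/-- The configurations that can be reached on the input `w`. -/
inductive Reachable (w : List TapeSymbol) : M.Config → Prop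
  | init : Reachable w M.init
  | step (b : Bool) {C : M.Config} : Reachable w C → Reachable w (M.step w b C)

theorem step_inputPos_le_of_lt {q : ℕ} {C : M.Config} (h : ¬ q ≤ C.inputPos) (w : List TapeSymbol)
    (b : Bool) : (M.step w b C).inputPos ≤ q :=
  (step_inputPos_le w b C).trans (by omega)

/-- The head advances by at most one cell, so it enters `q` exactly and the reward splits according
to the entering configuration. A set `S` that misses some of these only loses nonnegative terms; the
reverse inequality needs `S` to contain all reachable ones. -/
theorem acceptBefore_add_sum_hitProb_le {w : List TapeSymbol} {q : ℕ} {g : M.Config → ℝ}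
    (hg : ∀ C, C.inputPos = q → 0 ≤ g C) (S : Finset M.Config) (t : ℕ) (C : M.Config)
    (hC : C.inputPos ≤ q) :
    M.acceptBefore w q t C + ∑ C' ∈ S, M.hitProb w q C' t C * g C' ≤
      M.rewardUntil w q M.acceptIndicator g t C := by
  classical
  have hexit : ∀ C : M.Config, C.inputPos = q →
      0 + ∑ C' ∈ S, (if C = C' then 1 else 0) * g C' ≤ g C := by
    intro C hq
    simp only [ite_mul, one_mul, zero_mul, Finset.sum_ite_eq, zero_add]
    split_ifs
    exacts [le_rfl, hg C hq]
  induction t generalizing C with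
  | zero =>
    simp only [acceptBefore, hitProb, rewardUntil]
    by_cases h : q ≤ C.inputPos
    · simp only [h, if_true]
      exact hexit C (le_antisymm hC h)
    · simp [h]
  | succ t ih =>
    simp only [acceptBefore, hitProb, rewardUntil] at *
    by_cases h : q ≤ C.inputPos
    · simp only [h, if_true]
      exact hexit C (le_antisymm hC h)
    · simp only [h, if_false]
      have h1 := ih (M.step w true C) (step_inputPos_le_of_lt h w true)
      have h2 := ih (M.step w false C) (step_inputPos_le_of_lt h w false)
      simp only [add_div, add_mul, Finset.sum_add_distrib, div_mul_eq_mul_div, ← Finset.sum_div]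
      linarith

theorem rewardUntil_le_acceptBefore_add_sum_hitProb {w : List TapeSymbol} {q : ℕ}
    {g : M.Config → ℝ} {S : Finset M.Config}
    (hS : ∀ C, M.Reachable w C → C.inputPos = q → C ∈ S) (t : ℕ) (C : M.Config)
    (hr : M.Reachable w C) (hC : C.inputPos ≤ q) :
    M.rewardUntil w q M.acceptIndicator g t C ≤
      M.acceptBefore w q t C + ∑ C' ∈ S, M.hitProb w q C' t C * g C' := by
  classical
  have hexit : ∀ C : M.Config, M.Reachable w C → C.inputPos = q →
      g C ≤ 0 + ∑ C' ∈ S, (if C = C' then 1 else 0) * g C' := by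
    intro C hr hq
    simp only [ite_mul, one_mul, zero_mul, Finset.sum_ite_eq, zero_add, hS C hr hq, if_true, le_rfl]
  induction t generalizing C with
  | zero =>
    simp only [acceptBefore, hitProb, rewardUntil]
    by_cases h : q ≤ C.inputPos
    · simp only [h, if_true]
      exact hexit C hr (le_antisymm hC h)
    · simp [h]
  | succ t ih =>
    simp only [acceptBefore, hitProb, rewardUntil] at *
    by_cases h : q ≤ C.inputPos
    · simp only [h, if_true]
      exact hexit C hr (le_antisymm hC h)
    · simp only [h, if_false]
      have h1 := ih (M.step w true C) (hr.step true) (step_inputPos_le_of_lt h w true)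
      have h2 := ih (M.step w false C) (hr.step false) (step_inputPos_le_of_lt h w false)
      simp only [add_div, add_mul, Finset.sum_add_distrib, div_mul_eq_mul_div, ← Finset.sum_div]
      linarith

/-- Restarting the clock with `T` steps at `q` can only help, because fewer than or exactly `T`
steps are left there. This removes the remaining time from the data passed across the boundary, so
the rank will not depend on `T`. -/
theorem valueWithin_le_rewardUntil {w : List TapeSymbol} {q T : ℕ} {g : M.Config → ℝ}
    (hg : ∀ C, M.Reachable w C → C.inputPos = q → M.valueWithin w T C ≤ g C) (t : ℕ) (ht : t ≤ T)
    (C : M.Config) (hr : M.Reachable w C) (hC : C.inputPos ≤ q) :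
    M.valueWithin w t C ≤ M.rewardUntil w q M.acceptIndicator g t C := by
  by_cases h : q ≤ C.inputPos
  · have : M.rewardUntil w q M.acceptIndicator g t C = g C := by
      cases t <;> simp [rewardUntil, h]
    rw [this]
    exact (valueWithin_mono w C ht).trans (hg C hr (le_antisymm hC h))
  induction t generalizing C with
  | zero => simp [rewardUntil, h, valueWithin, expectedAfter]
  | succ t ih =>
    simp only [rewardUntil, h, if_false, valueWithin, expectedAfter]
    have key : ∀ b, M.valueWithin w t (M.step w b C) ≤
        M.rewardUntil w q M.acceptIndicator g t (M.step w b C) := by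
      intro b
      have hr' := hr.step b
      have hq' := step_inputPos_le_of_lt h w b
      by_cases h' : q ≤ (M.step w b C).inputPos
      · have : M.rewardUntil w q M.acceptIndicator g t (M.step w b C) = g (M.step w b C) := by
          cases t <;> simp [rewardUntil, h']
        rw [this]
        exact (valueWithin_mono w _ (by omega)).trans (hg _ hr' (le_antisymm hq' h'))
      · exact ih (by omega) _ hr' hq' h'
    have h1 := key true
    have h2 := key false
    simp only [valueWithin] at h1 h2
    linarith

/-- The price of the restarted clock: the time budgets of the two phases add up. -/
theorem rewardUntil_le_valueWithin {w : List TapeSymbol} {q s : ℕ} {g : M.Config → ℝ}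
    (hg : ∀ C, C.inputPos = q → g C ≤ M.valueWithin w s C) (t : ℕ)
    (C : M.Config) (hC : C.inputPos ≤ q) :
    M.rewardUntil w q M.acceptIndicator g t C ≤ M.valueWithin w (s + t) C := by
  induction t generalizing C with
  | zero =>
    unfold rewardUntil
    split_ifs with h
    · exact hg C (le_antisymm hC h)
    · exact valueWithin_mono w C (Nat.zero_le s)
  | succ t ih =>
    unfold rewardUntil
    split_ifs with h
    · exact (hg C (le_antisymm hC h)).trans (valueWithin_mono w C (by omega))
    · have h1 := ih _ (step_inputPos_le_of_lt h w true)
      have h2 := ih _ (step_inputPos_le_of_lt h w false)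
      rw [← add_assoc, valueWithin, expectedAfter]
      simp only [valueWithin] at h1 h2
      linarith

/-- If the input consists of segments each of which depends on `x` only or on `y` only, and at most
`K` configurations are possible at each input position, then the acceptance probability is
approximated by a function of small rectangle rank. -/
theorem exists_hasRectRank {X Y : Type} [Inhabited X] [Inhabited Y] (K T : ℕ)
    (S : ℕ → Finset M.Config) (hSpos : ∀ q, ∀ C ∈ S q, C.inputPos = q) (hScard : ∀ q, (S q).card ≤ K)
    (segs : List (X → Y → List TapeSymbol))
    (hlen : ∀ s ∈ segs, ∃ ℓ, ∀ x y, (s x y).length = ℓ)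
    (hside : ∀ s ∈ segs, (∀ x y y', s x y = s x y') ∨ (∀ x x' y, s x y = s x' y))
    (pre : X → Y → List TapeSymbol) (p : ℕ) (hp : ∀ x y, (pre x y).length = p)
    (hreach : ∀ x y C, M.Reachable (pre x y ++ (segs.map fun s => s x y).flatten) C →
      C ∈ S C.inputPos) :
    ∃ W : M.Config → X → Y → ℝ,
      (∀ C, C.inputPos = p → HasRectRank ((K + 1) ^ segs.length) (W C)) ∧
      (∀ x y C, C.inputPos = p → W C x y ≤
        M.valueWithin (pre x y ++ (segs.map fun s => s x y).flatten) ((segs.length + 1) * T) C) ∧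
      (∀ x y C, C.inputPos = p → M.Reachable (pre x y ++ (segs.map fun s => s x y).flatten) C →
        M.valueWithin (pre x y ++ (segs.map fun s => s x y).flatten) T C ≤ W C x y) ∧
      ∀ x y C, C.inputPos = p → 0 ≤ W C x y := by
  induction segs generalizing pre p with
  | nil =>
    -- Past the last segment the head sees only blanks, so the value no longer depends on `x` or
    -- `y`.
    have hV : ∀ x y C, C.inputPos = p → M.valueWithin (pre x y) T C =
        M.valueWithin (pre default default) T C := by
      intro x y C hC
      refine valueWithin_congr T C fun i hi => ?_
      rw [List.getElem?_eq_none (by rw [hp]; omega), List.getElem?_eq_none (by rw [hp]; omega)]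
    refine ⟨fun C _ _ => M.valueWithin (pre default default) T C, ?_, ?_, ?_, ?_⟩
    · intro C _
      simpa using HasRectRank.of_left (Y := Y) (f := fun _ : X =>
        M.valueWithin (pre default default) T C) (fun _ => valueWithin_nonneg _ _ _)
        (fun _ => valueWithin_le_one _ _ _)
    · intro x y C hC
      simp [hV x y C hC]
    · intro x y C hC _
      simp [hV x y C hC]
    · intro x y C _
      exact valueWithin_nonneg _ _ _
  | cons s segs ih =>
    obtain ⟨ℓ, hℓ⟩ := hlen s (by simp)
    obtain ⟨W, hW1, hW2, hW3, hW4⟩ := ih (fun s' h => hlen s' (by simp [h]))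
      (fun s' h => hside s' (by simp [h])) (fun x y => pre x y ++ s x y) (p + ℓ)
      (fun x y => by rw [List.length_append, hp, hℓ])
      (fun x y C hC => hreach x y C (by simpa using hC))
    set w : X → Y → List TapeSymbol := fun x y =>
      pre x y ++ ((s :: segs).map fun s => s x y).flatten with hw
    have hw' : ∀ x y, pre x y ++ s x y ++ (segs.map fun s => s x y).flatten = w x y := by
      intro x y; simp [hw]
    simp only [hw'] at hW2 hW3
    have hget : ∀ x y i, p ≤ i → i < p + ℓ → (w x y)[i]? = (s x y)[i - p]? := by
      intro x y i h1 h2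
      rw [← hw', List.append_assoc, List.getElem?_append_right (by rw [hp]; exact h1), hp,
        List.getElem?_append_left (by rw [hℓ]; omega)]
    -- Accept inside the segment `s`, or leave it in some `C'` and continue from there. The
    -- coefficients depend on one side only, so multiplying by them does not increase the rank.
    refine ⟨fun C x y => M.acceptBefore (w x y) (p + ℓ) T C +
      ∑ C' ∈ S (p + ℓ), M.hitProb (w x y) (p + ℓ) C' T C * W C' x y, ?_, ?_, ?_, ?_⟩
    · intro C hC
      have hA0 : ∀ v, 0 ≤ M.acceptBefore v (p + ℓ) T C := fun v =>
        rewardUntil_nonneg v _ acceptIndicator_nonneg (fun _ => le_rfl) T C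
      have hA1 : ∀ v, M.acceptBefore v (p + ℓ) T C ≤ 1 := fun v =>
        rewardUntil_le_one v _ acceptIndicator_le_one (fun _ => zero_le_one) T C
      have hH0 : ∀ C' v, 0 ≤ M.hitProb v (p + ℓ) C' T C := fun C' v =>
        rewardUntil_nonneg v _ (fun _ => le_rfl) (fun _ => by split_ifs <;> norm_num) T C
      have hH1 : ∀ C' v, M.hitProb v (p + ℓ) C' T C ≤ 1 := fun C' v =>
        rewardUntil_le_one v _ (fun _ => zero_le_one) (fun _ => by split_ifs <;> norm_num) T C
      -- The base `K + 1` instead of `K` absorbs the extra product for acceptance inside the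
      -- segment.
      have hR : 1 + (S (p + ℓ)).card * (K + 1) ^ segs.length ≤ (K + 1) ^ (s :: segs).length := by
        have h1 : 1 ≤ (K + 1) ^ segs.length := Nat.one_le_pow _ _ (by omega)
        have h2 := Nat.mul_le_mul_right ((K + 1) ^ segs.length) (hScard (p + ℓ))
        rw [List.length_cons, pow_succ]
        nlinarith
      have hWr : ∀ C' ∈ S (p + ℓ), HasRectRank ((K + 1) ^ segs.length) (W C') := fun C' h =>
        hW1 C' (hSpos _ C' h)
      rcases hside s (by simp) with h | h
      · have hc : ∀ (h g : M.Config → ℝ) x y, M.rewardUntil (w x y) (p + ℓ) h g T C =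
            M.rewardUntil (w x default) (p + ℓ) h g T C := by
          intro h' g x y
          refine rewardUntil_congr _ _ _ _ _ fun i h1 h2 => ?_
          rw [hget x y i (by omega) h2, hget x default i (by omega) h2, h x y default]
        simp only [acceptBefore, hitProb, hc]
        exact ((HasRectRank.of_left (fun x => hA0 (w x default)) (fun x => hA1 (w x default))).add
          (HasRectRank.sum _ fun C' h' => (hWr C' h').left_mul (fun x => hH0 C' (w x default))
            (fun x => hH1 C' (w x default)))).mono hR
      · have hc : ∀ (h g : M.Config → ℝ) x y, M.rewardUntil (w x y) (p + ℓ) h g T C =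
            M.rewardUntil (w default y) (p + ℓ) h g T C := by
          intro h' g x y
          refine rewardUntil_congr _ _ _ _ _ fun i h1 h2 => ?_
          rw [hget x y i (by omega) h2, hget default y i (by omega) h2, h x default y]
        simp only [acceptBefore, hitProb, hc]
        exact ((HasRectRank.of_right (fun y => hA0 (w default y)) (fun y => hA1 (w default y))).add
          (HasRectRank.sum _ fun C' h' => (hWr C' h').right_mul (fun y => hH0 C' (w default y))
            (fun y => hH1 C' (w default y)))).mono hR
    · intro x y C hC
      have h1 := acceptBefore_add_sum_hitProb_le (w := w x y) (q := p + ℓ)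
        (g := fun C => W C x y) (fun C h => hW4 x y C h) (S (p + ℓ)) T C (by omega)
      have h2 := rewardUntil_le_valueWithin (w := w x y) (q := p + ℓ)
        (g := fun C => W C x y) (fun C h => hW2 x y C h) T C (by omega)
      rw [List.length_cons, add_mul _ 1 T, one_mul]
      exact h1.trans h2
    · intro x y C hC hr
      have h1 := rewardUntil_le_acceptBefore_add_sum_hitProb (w := w x y) (q := p + ℓ)
        (g := fun C => W C x y) (S := S (p + ℓ)) (fun C h h' => h' ▸ hreach x y C h) T C hr
        (by omega)
      have h2 := valueWithin_le_rewardUntil (w := w x y) (q := p + ℓ) (T := T)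
        (g := fun C => W C x y) (fun C h h' => hW3 x y C h' h) T le_rfl C hr (by omega)
      exact h2.trans h1
    · intro x y C _
      refine add_nonneg (rewardUntil_nonneg _ _ acceptIndicator_nonneg (fun _ => le_rfl) T C)
        (Finset.sum_nonneg fun C' h => mul_nonneg ?_ (hW4 x y C' (hSpos _ C' h)))
      exact rewardUntil_nonneg _ _ (fun _ => le_rfl) (fun _ => by split_ifs <;> norm_num) T C

end OPTM

/-! ### Acceptance probability as a limit of finite-time values -/

namespace OPTM

variable {M : OPTM}

instance : IsProbabilityMeasure coinFlips := by
  unfold coinFlips; infer_instance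

theorem map_not_uniform_bool :
    ((PMF.uniformOfFintype Bool).toMeasure).map (fun b => !b) =
      (PMF.uniformOfFintype Bool).toMeasure := by
  classical
  ext s hs
  rw [Measure.map_apply (measurable_of_finite _) hs, PMF.toMeasure_uniformOfFintype_apply _ hs,
    PMF.toMeasure_uniformOfFintype_apply _ ((measurable_of_finite _) hs)]
  have : Fintype.card ((fun b => !b) ⁻¹' s) = Fintype.card s :=
    Fintype.card_congr (Equiv.boolNot.subtypeEquiv fun _ => Iff.rfl)
  rw [this]

theorem measurePreserving_flip (t : ℕ) :
    MeasurePreserving (fun (ω : ℕ → Bool) => Function.update ω t (!ω t)) coinFlips coinFlips := by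
  have hf : ∀ i, Measurable (fun b : Bool => if i = t then !b else b) := fun i =>
    measurable_of_finite _
  have e : (fun (ω : ℕ → Bool) => Function.update ω t (!ω t)) =
      fun ω i => (fun b : Bool => if i = t then !b else b) (ω i) := by
    funext ω i
    by_cases h : i = t
    · subst h; simp
    · simp [h]
  refine ⟨by rw [e]; exact measurable_pi_lambda _ fun i => (hf i).comp (measurable_pi_apply i), ?_⟩
  rw [e]
  unfold coinFlips
  rw [Measure.infinitePi_map_pi _ hf]
  congr 1
  funext i
  by_cases h : i = t
  · simp only [h, if_true]; exact map_not_uniform_bool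
  · simp only [h, if_false]; exact Measure.map_id

theorem run_congr (w : List TapeSymbol) {ω ω' : ℕ → Bool} (t : ℕ) (h : ∀ i < t, ω i = ω' i) :
    M.run w ω t = M.run w ω' t := by
  induction t with
  | zero => rfl
  | succ t ih => rw [run, run, ih fun i hi => h i (by omega), h t (by omega)]

theorem Reachable.exists_run {w : List TapeSymbol} {C : M.Config} (h : M.Reachable w C) :
    ∃ ω t, M.run w ω t = C := by
  induction h with
  | init => exact ⟨fun _ => true, 0, rfl⟩
  | step b _ ih =>
    obtain ⟨ω, t, rfl⟩ := ih
    refine ⟨Function.update ω t b, t + 1, ?_⟩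
    rw [run, Function.update_self, run_congr w t fun i hi => ?_]
    rw [Function.update_of_ne (by omega)]

/-- Configurations carry no σ-algebra. The induction runs over all `h`, since the last step can be
absorbed into `h` once its coin is fixed. -/
theorem measurable_comp_run (w : List TapeSymbol) (h : M.Config → ℝ) (t : ℕ) :
    Measurable fun ω => h (M.run w ω t) := by
  induction t generalizing h with
  | zero => simp only [run, measurable_const]
  | succ t ih =>
    have : (fun ω => h (M.run w ω (t + 1))) = fun ω =>
        if ω t = true then h (M.step w true (M.run w ω t))
        else h (M.step w false (M.run w ω t)) := by
      funext ω
      rw [run]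
      cases ω t <;> simp
    rw [this]
    have ht : MeasurableSet {ω : ℕ → Bool | ω t = true} :=
      measurableSet_eq_fun (measurable_pi_apply t) measurable_const
    exact Measurable.ite ht
      (ih fun C => h (M.step w true C)) (ih fun C => h (M.step w false C))

/-- `expectedAfter` unfolds at the first step and `run` at the last one; this exchanges the two. -/
theorem expectedAfter_succ (w : List TapeSymbol) (h : M.Config → ℝ) (t : ℕ) (C : M.Config) :
    M.expectedAfter w h (t + 1) C =
      M.expectedAfter w (fun C => (h (M.step w true C) + h (M.step w false C)) / 2) t C := by
  induction t generalizing C with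
  | zero => rfl
  | succ t ih => rw [expectedAfter, ih, ih]; rfl

/-- Flipping coin `t` preserves the measure and leaves the first `t` steps unchanged, so averaging a
run with its flipped copy averages over the last step; no conditional expectation is needed. -/
theorem integral_comp_run (w : List TapeSymbol) {h : M.Config → ℝ} {c : ℝ} (hc : ∀ C, |h C| ≤ c)
    (t : ℕ) : ∫ ω, h (M.run w ω t) ∂coinFlips = M.expectedAfter w h t M.init := by
  induction t generalizing h with
  | zero => simp [run, expectedAfter]
  | succ t ih =>
    have hint : ∀ {g : M.Config → ℝ}, (∀ C, |g C| ≤ c) → ∀ s,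
        Integrable (fun ω => g (M.run w ω s)) coinFlips := fun hg s =>
      Integrable.of_bound (measurable_comp_run w _ s).aestronglyMeasurable c
        (Filter.Eventually.of_forall fun ω => hg _)
    have hflip := (measurePreserving_flip t).integral_comp'
      (f := MeasurableEquiv.ofInvolutive _ (fun ω => by simp) (measurePreserving_flip t).measurable)
      (fun ω => h (M.run w ω (t + 1)))
    have hflip' : ∫ ω, h (M.run w (Function.update ω t (!ω t)) (t + 1)) ∂coinFlips =
        ∫ ω, h (M.run w ω (t + 1)) ∂coinFlips := hflip
    have hint' : Integrable (fun ω => h (M.run w (Function.update ω t (!ω t)) (t + 1)))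
        coinFlips :=
      (measurePreserving_flip t).integrable_comp_of_integrable (hint hc (t + 1))
    have hU : ∀ C, |(h (M.step w true C) + h (M.step w false C)) / 2| ≤ c := by
      intro C
      have h1 := abs_le.1 (hc (M.step w true C))
      have h2 := abs_le.1 (hc (M.step w false C))
      exact abs_le.2 ⟨by linarith, by linarith⟩
    rw [expectedAfter_succ, ← ih hU]
    have hpt : ∀ ω, (h (M.step w true (M.run w ω t)) + h (M.step w false (M.run w ω t))) / 2 =
        (h (M.run w ω (t + 1)) + h (M.run w (Function.update ω t (!ω t)) (t + 1))) / 2 := by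
      intro ω
      rw [run, run, Function.update_self,
        run_congr w (ω := Function.update ω t (!ω t)) (ω' := ω) t fun i hi => by
          rw [Function.update_of_ne (by omega)]]
      cases ω t
      · rw [add_comm]; rfl
      · rfl
    simp only [hpt]
    rw [integral_div, integral_add (hint hc (t + 1)) hint', hflip']
    ring

variable (M) in
/-- The event that the machine has accepted after `t` steps. -/
def acceptedBy (w : List TapeSymbol) (t : ℕ) : Set (ℕ → Bool) :=
  {ω | (M.run w ω t).state ∈ M.halting ∧ (M.run w ω t).state ∈ M.accepting}

theorem measureReal_acceptedBy (w : List TapeSymbol) (t : ℕ) :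
    coinFlips.real (M.acceptedBy w t) = M.valueWithin w t M.init := by
  have hind : (fun ω => M.acceptIndicator (M.run w ω t)) =
      (M.acceptedBy w t).indicator fun _ => (1 : ℝ) := by
    classical
    funext ω
    simp only [acceptIndicator, Set.indicator, acceptedBy, Set.mem_ofPred_eq]
    congr
  have hm : MeasurableSet (M.acceptedBy w t) := by
    have h := measurable_comp_run w M.acceptIndicator t
    have e : M.acceptedBy w t = (fun ω => M.acceptIndicator (M.run w ω t)) ⁻¹' {1} := by
      ext ω
      simp only [acceptedBy, acceptIndicator, Set.mem_ofPred_eq, Set.mem_preimage,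
        Set.mem_singleton_iff]
      split_ifs with h <;> simp [h]
    rw [e]
    exact h (measurableSet_singleton 1)
  have := integral_comp_run w (h := M.acceptIndicator) (c := 1) (fun C => by
    rw [abs_of_nonneg (acceptIndicator_nonneg C)]; exact acceptIndicator_le_one C) t
  rw [valueWithin, ← this, hind, integral_indicator_const _ hm, smul_eq_mul, mul_one]

theorem acceptedBy_mono (w : List TapeSymbol) : Monotone (M.acceptedBy w) := by
  refine monotone_nat_of_le_succ fun t ω h => ?_
  have : M.run w ω (t + 1) = M.run w ω t := by
    rw [run, step, if_pos h.1]
  simpa only [acceptedBy, Set.mem_ofPred_eq, this] using h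

theorem tendsto_valueWithin (w : List TapeSymbol) :
    Filter.Tendsto (fun t => M.valueWithin w t M.init) Filter.atTop (nhds (M.acceptProb w)) := by
  have e : {ω | M.Accepts w ω} = ⋃ t, M.acceptedBy w t := by
    ext ω; simp [Accepts, acceptedBy]
  simp only [← measureReal_acceptedBy, acceptProb, e, measureReal_def]
  exact (ENNReal.tendsto_toReal (measure_ne_top _ _)).comp
    (tendsto_measure_iUnion_atTop (acceptedBy_mono w))

theorem valueWithin_le_acceptProb (w : List TapeSymbol) (t : ℕ) :
    M.valueWithin w t M.init ≤ M.acceptProb w :=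
  (valueWithin_mono w M.init).ge_of_tendsto (tendsto_valueWithin w) t

end OPTM

/-! ### Counting configurations under a space bound -/

theorem TapeSymbol.exists_injective_fin : ∃ e : TapeSymbol → Fin 3, Function.Injective e := by
  refine ⟨fun s => match s with
    | .zero => 0
    | .one => 1
    | .sep => 2, ?_⟩
  intro a b h
  cases a <;> cases b <;> simp_all

instance : Finite TapeSymbol :=
  let ⟨_, he⟩ := TapeSymbol.exists_injective_fin
  Finite.of_injective _ he

theorem TapeSymbol.card_option_le [Fintype TapeSymbol] :
    Fintype.card (Option TapeSymbol) ≤ 4 := by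
  obtain ⟨e, he⟩ := TapeSymbol.exists_injective_fin
  have := Fintype.card_le_of_injective e he
  rw [Fintype.card_fin] at this
  rw [Fintype.card_option]
  omega

namespace OPTM

variable {M : OPTM}

theorem exists_workPos_eq (w : List TapeSymbol) (ω : ℕ → Bool) (t : ℕ) (z : ℤ)
    (hz : z ∈ Finset.uIcc 0 (M.run w ω t).workPos) : ∃ s, (M.run w ω s).workPos = z := by
  induction t with
  | zero => exact ⟨0, by simpa [run, init, eq_comm] using hz⟩
  | succ t ih =>
    have hstep : |(M.run w ω (t + 1)).workPos - (M.run w ω t).workPos| ≤ 1 := by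
      rw [run, step]
      split_ifs
      · simp
      · simp only [add_sub_cancel_left]
        generalize (M.trans (M.run w ω t).state w[(M.run w ω t).inputPos]?
          ((M.run w ω t).work (M.run w ω t).workPos) (ω t)).workMove = m
        cases m <;> simp [WorkMove.offset]
    by_cases h : z ∈ Finset.uIcc 0 (M.run w ω t).workPos
    · exact ih h
    · refine ⟨t + 1, ?_⟩
      rw [Finset.mem_uIcc] at hz h
      rw [abs_le] at hstep
      omega

/-- The work head moves by at most one cell, so every cell between the origin and its position has
been scanned. -/
theorem natAbs_lt_of_cellsUsed {w : List TapeSymbol} {ω : ℕ → Bool} {m : ℕ}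
    (h : (M.cellsUsed w ω).encard ≤ (m : ℕ∞)) (t : ℕ) : (M.run w ω t).workPos.natAbs < m := by
  have hsub : ((Finset.uIcc 0 (M.run w ω t).workPos : Finset ℤ) : Set ℤ) ⊆ M.cellsUsed w ω :=
    fun z hz => exists_workPos_eq w ω t z hz
  have h1 := (Set.encard_le_encard hsub).trans h
  rw [Set.encard_coe_eq_coe_finsetCard, Int.card_uIcc] at h1
  have h2 : ((M.run w ω t).workPos - 0).natAbs + 1 ≤ m := by exact_mod_cast h1
  rw [sub_zero] at h2
  omega

theorem exists_workPos_eq_of_work_ne_none (w : List TapeSymbol) (ω : ℕ → Bool) (t : ℕ) (z : ℤ)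
    (hz : (M.run w ω t).work z ≠ none) : ∃ s, (M.run w ω s).workPos = z := by
  induction t with
  | zero => simp [run, init] at hz
  | succ t ih =>
    by_cases h : (M.run w ω t).workPos = z
    · exact ⟨t, h⟩
    · refine ih ?_
      rw [run, step] at hz
      split_ifs at hz
      · exact hz
      · simpa only [Function.update_of_ne (Ne.symm h)] using hz

variable (M) in
/-- The configuration with input position `q`, whose work tape is blank outside `[-m, m]`, that is
given by a state, a head position in that interval and a content of that interval. -/
def windowConfig (m q : ℕ) (d : M.Q × Fin (2 * m + 1) × (Fin (2 * m + 1) → Option TapeSymbol)) :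
    M.Config where
  state := d.1
  inputPos := q
  workPos := (d.2.1 : ℕ) - (m : ℤ)
  work := fun z =>
    if h : (z + m).toNat < 2 * m + 1 ∧ 0 ≤ z + m then d.2.2 ⟨(z + m).toNat, h.1⟩ else none

variable (M) in
theorem exists_windowConfigs (m : ℕ) : ∃ S : ℕ → Finset M.Config,
    (∀ q, ∀ C ∈ S q, C.inputPos = q) ∧
    (∀ q, (S q).card ≤ Nat.card M.Q * ((2 * m + 1) * 4 ^ (2 * m + 1))) ∧
    ∀ C : M.Config, C.workPos.natAbs ≤ m → (∀ z, C.work z ≠ none → z.natAbs ≤ m) →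
      C ∈ S C.inputPos := by
  classical
  have := M.finite_Q
  have := Fintype.ofFinite M.Q
  have := Fintype.ofFinite TapeSymbol
  refine ⟨fun q => Finset.univ.image (M.windowConfig m q), ?_, ?_, ?_⟩
  · intro q C hC
    obtain ⟨d, _, rfl⟩ := Finset.mem_image.1 hC
    rfl
  · intro q
    refine Finset.card_image_le.trans ?_
    rw [Finset.card_univ, Fintype.card_prod, Fintype.card_prod, Fintype.card_fun, Fintype.card_fin,
      Nat.card_eq_fintype_card]
    gcongr
    exact TapeSymbol.card_option_le
  · intro C h1 h2
    refine Finset.mem_image.2 ⟨(C.state, ⟨(C.workPos + m).toNat, by omega⟩,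
      fun i => C.work ((i : ℕ) - (m : ℤ))), Finset.mem_univ _, ?_⟩
    obtain ⟨s, q, p, f⟩ := C
    simp only at h1 h2
    simp only [windowConfig, Config.mk.injEq, true_and]
    refine ⟨by omega, ?_⟩
    funext z
    split_ifs with h
    · congr 1; omega
    · by_contra hne
      have := h2 z (Ne.symm hne)
      omega

/-- If two parties hold `x` and `y` and the input consists of segments that depend on `x` only or on
`y` only, then within a space bound the acceptance probability has an approximation of small
rectangle rank. -/
theorem exists_hasRectRank_of_space {X Y : Type} [Inhabited X] [Inhabited Y] [Finite X] [Finite Y]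
    (m : ℕ) (segs : List (X → Y → List TapeSymbol))
    (hlen : ∀ s ∈ segs, ∃ ℓ, ∀ x y, (s x y).length = ℓ)
    (hside : ∀ s ∈ segs, (∀ x y y', s x y = s x y') ∨ (∀ x x' y, s x y = s x' y))
    (hspace : ∀ x y ω, (M.cellsUsed (segs.map fun s => s x y).flatten ω).encard ≤ (m : ℕ∞))
    {ε : ℝ} (hε : 0 < ε) :
    ∃ P : X → Y → ℝ,
      HasRectRank ((Nat.card M.Q * ((2 * m + 1) * 4 ^ (2 * m + 1)) + 1) ^ segs.length) P ∧
      ∀ x y, P x y ≤ M.acceptProb (segs.map fun s => s x y).flatten ∧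
        M.acceptProb (segs.map fun s => s x y).flatten - ε ≤ P x y := by
  obtain ⟨S, hS1, hS2, hS3⟩ := M.exists_windowConfigs m
  -- The machine need not halt, but there are finitely many pairs `(x, y)`, so one time bound serves
  -- them all.
  have hT : ∀ᶠ T in Filter.atTop, ∀ x : X, ∀ y : Y,
      M.acceptProb (segs.map fun s => s x y).flatten - ε <
        M.valueWithin (segs.map fun s => s x y).flatten T M.init := by
    rw [Filter.eventually_all]
    intro x
    rw [Filter.eventually_all]
    intro y
    exact (tendsto_valueWithin _).eventually (lt_mem_nhds (by linarith))
  obtain ⟨T, hT⟩ := hT.exists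
  obtain ⟨W, hW1, hW2, hW3, -⟩ := exists_hasRectRank _ T S hS1 hS2 segs hlen hside
    (fun _ _ => []) 0 (fun _ _ => rfl) (fun x y C hC => by
      obtain ⟨ω, t, rfl⟩ := hC.exists_run
      rw [List.nil_append]
      refine hS3 _ (natAbs_lt_of_cellsUsed (hspace x y ω) t).le fun z hz => ?_
      obtain ⟨s, rfl⟩ := exists_workPos_eq_of_work_ne_none _ ω t z hz
      exact (natAbs_lt_of_cellsUsed (hspace x y ω) s).le)
  simp only [List.nil_append] at hW2 hW3
  refine ⟨W M.init, hW1 _ rfl, fun x y => ⟨?_, ?_⟩⟩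
  · exact (hW2 x y _ rfl).trans (valueWithin_le_acceptProb _ _)
  · exact (hT x y).le.trans (hW3 x y _ rfl Reachable.init)

end OPTM

/-! ### The words of the disjointness language -/

/-- The segments `1^k #` and `2^k` times `x#`, `y#`, `x#` of the word `disjWord k x y`. -/
def disjSegments (k : ℕ) : List ((Fin (2 ^ (2 * k)) → Bool) → (Fin (2 ^ (2 * k)) → Bool) →
    List TapeSymbol) :=
  (fun _ _ => List.replicate k TapeSymbol.one ++ [TapeSymbol.sep]) ::
    (List.replicate (2 ^ k) [fun x _ => bitWord x ++ [TapeSymbol.sep],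
      fun _ y => bitWord y ++ [TapeSymbol.sep], fun x _ => bitWord x ++ [TapeSymbol.sep]]).flatten

theorem length_disjSegments (k : ℕ) : (disjSegments k).length = 3 * 2 ^ k + 1 := by
  simp [disjSegments, mul_comm]

theorem flatten_disjSegments (k : ℕ) (x y : Fin (2 ^ (2 * k)) → Bool) :
    ((disjSegments k).map fun s => s x y).flatten = disjWord k x y := by
  have h : ∀ (n : ℕ) (l : List ((Fin (2 ^ (2 * k)) → Bool) → (Fin (2 ^ (2 * k)) → Bool) →
      List TapeSymbol)), ((List.replicate n l).flatten.map fun s => s x y).flatten =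
      (List.replicate n (l.map fun s => s x y).flatten).flatten := by
    intro n l
    induction n with
    | zero => rfl
    | succ n ih =>
      rw [List.replicate_succ, List.flatten_cons, List.map_append, List.flatten_append, ih,
        List.replicate_succ, List.flatten_cons]
  rw [disjSegments, List.map_cons, List.flatten_cons, h, disjWord]
  simp [disjBlock]

theorem length_bitWord {n : ℕ} (x : Fin n → Bool) : (bitWord x).length = n := by
  simp [bitWord]

theorem mem_disjSegments {k : ℕ} {s} (hs : s ∈ disjSegments k) :
    (∃ v, s = fun _ _ => v) ∨ (s = fun x _ => bitWord x ++ [TapeSymbol.sep]) ∨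
      (s = fun _ y => bitWord y ++ [TapeSymbol.sep]) := by
  rw [disjSegments, List.mem_cons, List.mem_flatten] at hs
  rcases hs with rfl | ⟨l, hl, hs⟩
  · exact Or.inl ⟨_, rfl⟩
  · rw [List.eq_of_mem_replicate hl] at hs
    simp only [List.mem_cons, List.not_mem_nil, or_false] at hs
    tauto

theorem length_disjBlock {n : ℕ} (x y : Fin n → Bool) : (disjBlock x y).length = 3 * n + 3 := by
  simp [disjBlock, length_bitWord]; ring

theorem length_disjWord (k : ℕ) (x y : Fin (2 ^ (2 * k)) → Bool) :
    (disjWord k x y).length = k + 1 + 2 ^ k * (3 * 2 ^ (2 * k) + 3) := by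
  simp [disjWord, length_disjBlock]; ring

theorem bitWord_injective {n : ℕ} : Function.Injective (bitWord (n := n)) := by
  intro x y h
  have h' := List.ofFn_injective h
  funext i
  have := congrFun h' i
  revert this
  cases x i <;> cases y i <;> simp [TapeSymbol.ofBit]

theorem disjWord_mem_LDISJ_iff {k : ℕ} (hk : 1 ≤ k) (x y : Fin (2 ^ (2 * k)) → Bool) :
    disjWord k x y ∈ LDISJ ↔ ∀ i, (!x i || !y i) = true := by
  constructor
  · rintro ⟨k', hk', x', y', hd, he⟩
    have hkk : k = k' := by
      -- The length of the word determines `k`; then the first block determines `x` and `y`.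
      have hmono : StrictMono fun k : ℕ => k + 1 + 2 ^ k * (3 * 2 ^ (2 * k) + 3) := by
        intro a b hab
        have h1 : 2 ^ a ≤ 2 ^ b := Nat.pow_le_pow_right (by norm_num) hab.le
        have h2 : 2 ^ (2 * a) ≤ 2 ^ (2 * b) := Nat.pow_le_pow_right (by norm_num) (by omega)
        have h3 : 2 ^ a * (3 * 2 ^ (2 * a) + 3) ≤ 2 ^ b * (3 * 2 ^ (2 * b) + 3) :=
          Nat.mul_le_mul h1 (by omega)
        simp only
        omega
      have hl := congrArg List.length he
      rw [length_disjWord, length_disjWord] at hl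
      exact hmono.injective hl
    subst hkk
    obtain ⟨n, hn⟩ : ∃ n, 2 ^ k = n + 1 := ⟨2 ^ k - 1, (Nat.sub_add_cancel Nat.one_le_two_pow).symm⟩
    rw [disjWord, disjWord, hn, List.replicate_succ, List.replicate_succ, List.flatten_cons,
      List.flatten_cons] at he
    have h1 := List.append_cancel_left he
    have h2 := (List.append_inj h1 (by rw [length_disjBlock, length_disjBlock])).1
    simp only [disjBlock, List.append_assoc] at h2
    have h3 := List.append_inj h2 (by rw [length_bitWord, length_bitWord])
    have h4 := List.append_inj (List.append_cancel_left h3.2)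
      (by rw [length_bitWord, length_bitWord])
    rw [bitWord_injective h3.1, bitWord_injective h4.1]
    simpa [DISJ] using hd
  · intro h
    exact ⟨k, hk, x, y, by simpa [DISJ] using h, rfl⟩

theorem rpow_length_disjWord_le {k : ℕ} (x y : Fin (2 ^ (2 * k)) → Bool) :
    ((disjWord k x y).length : ℝ) ^ ((1 : ℝ) / 3) ≤ 2 * 2 ^ k := by
  have h : (disjWord k x y).length ≤ (2 * 2 ^ k) ^ 3 := by
    rw [length_disjWord]
    have h1 : k + 1 ≤ 2 ^ k := Nat.lt_two_pow_self
    have h2 : 2 ^ (2 * k) = (2 ^ k) ^ 2 := by rw [← pow_mul, mul_comm]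
    rw [h2]
    have h3 : 1 ≤ 2 ^ k := Nat.one_le_two_pow
    generalize 2 ^ k = B at h1 h3 ⊢
    have h4 : B ≤ B ^ 3 := Nat.le_self_pow (by norm_num) B
    nlinarith
  have h' : ((disjWord k x y).length : ℝ) ≤ (2 * 2 ^ k : ℝ) ^ (3 : ℕ) := by exact_mod_cast h
  calc ((disjWord k x y).length : ℝ) ^ ((1 : ℝ) / 3)
      ≤ ((2 * 2 ^ k : ℝ) ^ (3 : ℕ)) ^ ((1 : ℝ) / 3) :=
        Real.rpow_le_rpow (by positivity) h' (by norm_num)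
    _ = 2 * 2 ^ k := by
        rw [← Real.rpow_natCast, ← Real.rpow_mul (by positivity)]
        norm_num

/-! ### Comparison of growth rates -/

/-- A space bounded machine for disjointness leads to an inequality between the number of its
configurations and the length of the strings. -/
theorem exp_le_of_OPTM {M : OPTM} {s : ℕ → ℕ} (hM : ∀ w : List TapeSymbol,
    (w ∈ LDISJ → 2 / 3 ≤ M.acceptProb w) ∧ (w ∉ LDISJ → M.acceptProb w < 1 / 3) ∧
    M.UsesSpaceAtMost w (s w.length)) {k m : ℕ} (hk : 1 ≤ k)
    (hm : max 1 (s (k + 1 + 2 ^ k * (3 * 2 ^ (2 * k) + 3))) ≤ m) :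
    Real.exp ((2 ^ k) ^ 2 / 10368) ≤
      180 * (Nat.card M.Q * ((2 * m + 1) * 4 ^ (2 * m + 1)) + 1 : ℝ) ^ (3 * 2 ^ k + 1) := by
  obtain ⟨P, hP, hP'⟩ := M.exists_hasRectRank_of_space m (disjSegments k)
    (by
      intro s hs
      rcases mem_disjSegments hs with ⟨v, rfl⟩ | rfl | rfl
      · exact ⟨_, fun _ _ => rfl⟩
      · exact ⟨2 ^ (2 * k) + 1, fun x y => by simp [length_bitWord]⟩
      · exact ⟨2 ^ (2 * k) + 1, fun x y => by simp [length_bitWord]⟩)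
    (by
      intro s hs
      rcases mem_disjSegments hs with ⟨v, rfl⟩ | rfl | rfl
      · exact Or.inl fun _ _ _ => rfl
      · exact Or.inl fun _ _ _ => rfl
      · exact Or.inr fun _ _ _ => rfl)
    (by
      intro x y ω
      rw [flatten_disjSegments]
      refine ((hM (disjWord k x y)).2.2 ω).trans ?_
      rw [length_disjWord]
      exact_mod_cast hm)
    -- `2 / 3 - 1 / 15 = 3 / 5`, the threshold for disjoint pairs in `exp_le_of_disjointness`.
    (ε := 1 / 15) (by norm_num)
  simp only [flatten_disjSegments] at hP'
  have h := hP.exp_le_of_disjointness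
    (fun x y hd => by
      have h1 := (hM _).1 ((disjWord_mem_LDISJ_iff hk x y).2 hd)
      linarith [(hP' x y).2])
    (fun x y hd => by
      have h1 := (hM _).2.1 (mt (disjWord_mem_LDISJ_iff hk x y).1 hd)
      linarith [(hP' x y).1])
  rw [Fintype.card_fin, length_disjSegments] at h
  push_cast at h
  rwa [mul_comm 2 k, pow_mul] at h

theorem card_mul_le_exp {c m : ℕ} (hc : 1 ≤ c) :
    (c * ((2 * m + 1) * 4 ^ (2 * m + 1)) + 1 : ℝ) ≤ 2 * c * Real.exp (3 * (2 * m + 1)) := by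
  have h2 : (2 * m + 1 : ℝ) ≤ 2 ^ (2 * m + 1) := by
    exact_mod_cast (Nat.lt_two_pow_self (n := 2 * m + 1)).le
  have h3 : (2 : ℝ) ^ (2 * m + 1) * 4 ^ (2 * m + 1) = 8 ^ (2 * m + 1) := by
    rw [← mul_pow]; norm_num
  have h4 : (8 : ℝ) ^ (2 * m + 1) ≤ Real.exp (3 * (2 * m + 1)) := by
    have e : Real.exp (3 * (2 * m + 1)) = (Real.exp 1 ^ 3) ^ (2 * m + 1) := by
      rw [← pow_mul, ← Real.exp_nat_mul]; congr 1; push_cast; ring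
    rw [e]
    refine pow_le_pow_left₀ (by norm_num) ?_ _
    have : (2 : ℝ) ≤ Real.exp 1 := by linarith [Real.add_one_le_exp (1 : ℝ)]
    calc (8 : ℝ) = 2 ^ 3 := by norm_num
      _ ≤ _ := pow_le_pow_left₀ (by norm_num) this 3
  have hc' : (1 : ℝ) ≤ c := by exact_mod_cast hc
  have h5 : (1 : ℝ) ≤ Real.exp (3 * (2 * m + 1)) := Real.one_le_exp (by positivity)
  have h6 : ((2 * m + 1 : ℝ) * 4 ^ (2 * m + 1)) ≤ Real.exp (3 * (2 * m + 1)) :=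
    (mul_le_mul_of_nonneg_right h2 (by positivity)).trans (h3.trans_le h4)
  have h7 := mul_le_mul_of_nonneg_left h6 (by positivity : (0 : ℝ) ≤ c)
  nlinarith

theorem mainTheorem3 :
    ∃ c₁ : ℝ, 0 < c₁ ∧ LDISJ ∉ OBPSPACE (fun n : ℕ => ⌊c₁ * (n : ℝ) ^ ((1 : ℝ) / 3)⌋₊) := by
  refine ⟨1 / 10 ^ 7, by norm_num, ?_⟩
  rintro ⟨M, hM⟩
  have := M.finite_Q
  have : Nonempty M.Q := ⟨M.start⟩
  have hQ : 1 ≤ Nat.card M.Q := Nat.card_pos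
  set A : ℝ := Real.log (2 * Nat.card M.Q) with hA
  have hQ' : (1 : ℝ) ≤ Nat.card M.Q := by exact_mod_cast hQ
  have hA0 : 0 ≤ A := Real.log_nonneg (by linarith)
  -- Since `20736 = 2 * 10368`, half of the exponent `B ^ 2 / 10368` beats the terms linear in `B`
  -- and the constant `180`. The other half beats the quadratic term `48 B ^ 2 / 10 ^ 7` that comes
  -- from the space bound.
  obtain ⟨k, hk⟩ := pow_unbounded_of_one_lt (20736 * (4 * (A + 9) + 180)) (one_lt_two (α := ℝ))
  have hk1 : 1 ≤ k := by
    rcases Nat.eq_zero_or_pos k with rfl | h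
    · rw [pow_zero] at hk; linarith
    · exact h
  have hB1 : (1 : ℝ) ≤ 2 ^ k := one_le_pow₀ one_le_two
  set n := k + 1 + 2 ^ k * (3 * 2 ^ (2 * k) + 3) with hn
  set m := max 1 ⌊(1 / 10 ^ 7 : ℝ) * (n : ℝ) ^ ((1 : ℝ) / 3)⌋₊ with hmdef
  have hm : (m : ℝ) ≤ 1 + 2 * 2 ^ k / 10 ^ 7 := by
    have h1 := rpow_length_disjWord_le (k := k) (fun _ => false) (fun _ => false)
    rw [length_disjWord, ← hn] at h1
    have h2 : (⌊(1 / 10 ^ 7 : ℝ) * (n : ℝ) ^ ((1 : ℝ) / 3)⌋₊ : ℝ) ≤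
      (1 / 10 ^ 7 : ℝ) * (n : ℝ) ^ ((1 : ℝ) / 3) := Nat.floor_le (by positivity)
    rw [hmdef, Nat.cast_max, Nat.cast_one]
    refine max_le (by linarith [show (0 : ℝ) ≤ 2 * 2 ^ k / 10 ^ 7 by positivity]) ?_
    linarith
  have key := exp_le_of_OPTM (s := fun n : ℕ => ⌊(1 / 10 ^ 7 : ℝ) * (n : ℝ) ^ ((1 : ℝ) / 3)⌋₊) hM hk1
    (m := m) le_rfl
  set B : ℝ := 2 ^ k with hB
  -- `3 * (2 * m + 1)` is at most `9 + 12 * B / 10 ^ 7` by `hm`.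
  have hbase : (Nat.card M.Q * ((2 * m + 1) * 4 ^ (2 * m + 1)) + 1 : ℝ) ≤
      Real.exp (A + 9 + 12 * B / 10 ^ 7) := by
    refine (card_mul_le_exp hQ).trans ?_
    rw [← Real.exp_log (show (0 : ℝ) < 2 * Nat.card M.Q by linarith), ← hA, ← Real.exp_add]
    exact Real.exp_le_exp.2 (by linarith)
  have hpow : (Nat.card M.Q * ((2 * m + 1) * 4 ^ (2 * m + 1)) + 1 : ℝ) ^ (3 * 2 ^ k + 1) ≤
      Real.exp ((3 * B + 1) * (A + 9 + 12 * B / 10 ^ 7)) := by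
    refine (pow_le_pow_left₀ (by positivity) hbase _).trans_eq ?_
    rw [← Real.exp_nat_mul]
    push_cast
    rfl
  have h180 : (180 : ℝ) ≤ Real.exp 180 := by linarith [Real.add_one_le_exp (180 : ℝ)]
  have hexp := key.trans (mul_le_mul h180 hpow (by positivity) (Real.exp_pos _).le)
  rw [← Real.exp_add, Real.exp_le_exp] at hexp
  have h1 : (3 * B + 1) * (A + 9 + 12 * B / 10 ^ 7) ≤ 4 * B * (A + 9 + 12 * B / 10 ^ 7) :=
    mul_le_mul_of_nonneg_right (by linarith) (by positivity)
  have h2 : B * (20736 * (4 * (A + 9) + 180)) < B * B :=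
    mul_lt_mul_of_pos_left hk (by linarith)
  have h3 : 0 ≤ B * B := by positivity
  linarith
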